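/- Let $L$ be a poset. An element $x\in L$ is \emph{compact} if whenever $D\subseteq L$ is a (nonempty) directed subset that has a supremum and $x\le\bigvee D$, then $x\le d$ for some $d\in D$; the \emph{downset} of $x$ is $\{y\in L: y\le x\}$. Consider the conditions: (1) every (nonempty) directed subset of $L$ has a supremum; (2) every nonempty subset of $L$ has an infimum; (3) every element of $L$ is the supremum of a directed set of compact elements; (4) the downset of every compact element is dual to a finite partition lattice, i.e. order-anti-isomorphic to the lattice of partitions of some finite set, ordered by refinement. The poset $L$ is called a \emph{piecewise Boolean domain} if it satisfies (1)--(4). A \emph{geometric lattice} is a finite atomistic lattice in which $x\vee y$ covers $y$ whenever $x$ covers $x\wedge y$; a lattice is \emph{cogeometric} if it is dual to a geometric lattice. An element $x$ of a lattice is \emph{modular} if $a\vee(x\wedge y)=(a\vee x)\wedge y$ for all $a\le y$. The \emph{height} of an element is the supremum of the lengths $k$ of chains $x_0<x_1<\dots<x_k$ that end at that element. \textbf{Proposition.} A poset $L$ is a piecewise Boolean domain if and only if it satisfies (1)--(3) together with the following two conditions: (4') the downset of every compact element is a cogeometric lattice, and, unless the element is minimal (i.e. the least element) in $L$, this downset has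 a modular atom; (4'') every element of $L$ of height $n\le 3$ covers exactly $\binom{n+1}{2}$ elements. -/

import Mathlib

universe u

/-- The first three conditions: every (nonempty) directed subset has a supremum, every nonempty
subset has an infimum, and every element is the supremum of a directed set of compact elements. -/
structure IsScottDomain (L : Type u) [PartialOrder L] : Prop where
  directed_sup : ∀ D : Set L, D.Nonempty → DirectedOn (· ≤ ·) D → ∃ s, IsLUB D s
  nonempty_inf : ∀ S : Set L, S.Nonempty → ∃ i, IsGLB S i
  algebraic : ∀ x : L, ∃ D : Set L, (∀ k ∈ D, IsCompactElement k) ∧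
    D.Nonempty ∧ DirectedOn (· ≤ ·) D ∧ IsLUB D x

/-- A poset that is dual to a finite partition lattice. Partitions of a finite set are given by
equivalence relations; Mathlib orders them by refinement, with the partition into singletons as
the least element. -/
def IsDualToFinitePartitionLattice (α : Type u) [PartialOrder α] : Prop :=
  ∃ n : ℕ, Nonempty (α ≃o (Setoid (Fin n))ᵒᵈ)

/-- Piecewise Boolean domains. -/
structure IsPiecewiseBooleanDomain (L : Type u) [PartialOrder L] : Prop
    extends IsScottDomain L where
  downset : ∀ x : L, IsCompactElement x → IsDualToFinitePartitionLattice (Set.Iic x)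

/-- A geometric lattice: a finite atomistic (upper) semimodular lattice. -/
structure IsGeometricLattice (G : Type u) [Lattice G] [OrderBot G] : Prop where
  finite : Finite G
  atomistic : IsAtomistic G
  semimodular : ∀ x y : G, x ⊓ y ⋖ x → y ⋖ x ⊔ y

/-- A poset is cogeometric when it is dual to a geometric lattice. -/
def IsCogeometric (α : Type u) [PartialOrder α] : Prop :=
  ∃ (G : Type u) (_ : Lattice G) (_ : BoundedOrder G),
    IsGeometricLattice G ∧ Nonempty (α ≃o Gᵒᵈ)

/-- An element `x` of a lattice is modular when `a ∨ (x ∧ y) = (a ∨ x) ∧ y` for all `a ≤ y`. -/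
def IsModularElement {M : Type u} [Lattice M] (x : M) : Prop :=
  ∀ a y : M, a ≤ y → a ⊔ (x ⊓ y) = (a ⊔ x) ⊓ y

/-- The poset `α` is a bounded lattice that has a modular atom. As a lattice structure is
determined by its order, the choice of the isomorphic copy `M` does not matter. -/
def HasModularAtom (α : Type u) [PartialOrder α] : Prop :=
  ∃ (M : Type u) (_ : Lattice M) (_ : BoundedOrder M),
    Nonempty (α ≃o M) ∧ ∃ z : M, IsAtom z ∧ IsModularElement z

/-!
Everything takes place in the dual `G` of the downset of a compact element, a finite geometric
lattice; the downset of an element `w ≤ x` becomes an upper interval `[y, ⊤]` of `G`, the height of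
`w` becomes the corank of `y`, and the elements covered by `w` become the covers of `y`.

For the partition lattice itself, `S` covers `R` if and only if it merges two blocks of `R`. This
gives semimodularity, atomisticity, the count of the atoms and the rank; splitting off a single
point is a modular coatom.

Conversely, let every upper interval `[y, ⊤]` of `G` have a modular coatom and, when its rank `r` is
at most three, exactly `(r + 1).choose 2` atoms. If `H` is a modular coatom of `[y, ⊤]` and `p` is
an atom of `[y, ⊤]` off `H`, then `[y, H]` and `[p, ⊤]` are isomorphic, by `t ↦ t ⊔ p` and
`z ↦ z ⊓ H`. The argument then has two steps.

* The count of atoms holds in every rank `r` (`ncard_covBy_eq_choose`). By downward induction `H`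
  contains `r.choose 2` atoms, and each of them is on `r - 1` lines not contained in `H`. Since
  lines have at most three atoms (`ncard_covBy_le_three`), sorting the pairs of the `m` atoms off
  `H` by the point where their line meets `H` gives
  `m * (m - 1) = r.choose 2 * 2 * (m - (r - 1))`, that is, `m = r` or `m = (r - 1) ^ 2`, and the latter exceeds the bound `m ≤ 2 * (r - 1)` if `4 ≤ r`.
* Now let `y = ⊥`. The `r` atoms off `H` together with one more point form a set of `r + 1` points.
  Each pair of them gives an atom: `p` for the new point and `p`, and `(p ⊔ q) ⊓ H` for `p` and `q`.
  Every atom arises, since an atom of `H` is on fewer lines off `H` than there are atoms off `H`.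
  Triangles are dependent, and together with the rank this forces `G` to be the lattice of
  partitions of these points (`nonempty_orderIso_setoid`): a spanning forest with two components
  cannot span `G`.
-/

/-! ### Coheight in semimodular lattices and the partition lattice -/

/-- In a finite upper semimodular lattice, all maximal chains above a given element have the same
length. -/
theorem coheight_eq_of_covBy {G : Type*} [Lattice G] [Finite G] [IsUpperModularLattice G] {a b : G}
    (h : a ⋖ b) : Order.coheight a = Order.coheight b + 1 := by
  induction a using WellFoundedGT.induction generalizing b with
  | ind a ih =>
    refine le_antisymm ?_ (Order.coheight_add_one_le h.lt)
    rw [Order.coheight_eq_iSup_gt_coheight]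
    refine iSup₂_le fun c hc => ?_
    obtain ⟨d, had, hdc⟩ := exists_covBy_le_of_lt hc
    refine add_le_add_left ((Order.coheight_anti hdc).trans ?_) 1
    by_cases hdb : d = b
    · rw [hdb]
    · have hinf : b ⊓ d = a :=
        (h.eq_or_eq (le_inf h.le had.le) inf_le_left).resolve_right fun hb =>
          hdb (had.eq_or_eq h.le (inf_eq_left.1 hb) |>.resolve_left h.lt.ne').symm
      have h1 : d ⋖ b ⊔ d := covBy_sup_of_inf_covBy_left (hinf.symm ▸ h)
      have h2 : b ⋖ b ⊔ d := covBy_sup_of_inf_covBy_right (hinf.symm ▸ had)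
      rw [ih d had.lt h1, ih b h.lt h2]

namespace PartitionLattice

variable {V : Type*}

instance finite [Finite V] : Finite (Setoid V) :=
  Finite.of_injective (fun R : Setoid V => (R : V → V → Prop)) fun _ _ h =>
    Setoid.eq_iff_rel_eq.2 h

/-- The partition of `V` whose only block that may have more than one element is `s`. -/
def block (s : Set V) : Setoid V where
  r a b := a = b ∨ (a ∈ s ∧ b ∈ s)
  iseqv := ⟨fun _ => Or.inl rfl, by rintro a b (h | h) <;> simp_all,
    by rintro a b c (rfl | h) (rfl | h') <;> simp_all⟩

theorem block_apply {s : Set V} {a b : V} : block s a b ↔ a = b ∨ (a ∈ s ∧ b ∈ s) := Iff.rfl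

theorem block_pair_le {R : Setoid V} {i j : V} : block {i, j} ≤ R ↔ R i j := by
  constructor
  · intro h
    exact h (block_apply.2 (Or.inr ⟨by simp, by simp⟩))
  · rintro h a b (rfl | ⟨rfl | rfl, rfl | rfl⟩)
    · exact R.refl' _
    · exact R.refl' _
    · exact h
    · exact R.symm' h
    · exact R.refl' _

/-- Joining with the pair `{i, j}` merges the blocks of `i` and `j` and does nothing else. -/
theorem sup_block_pair_apply {R : Setoid V} {i j a b : V} (h : (R ⊔ block {i, j}) a b) :
    R a b ∨ (R a i ∧ R j b) ∨ (R a j ∧ R i b) := by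
  rw [Setoid.sup_eq_eqvGen] at h
  replace h : Relation.EqvGen (fun x y => R x y ∨ block {i, j} x y) a b := h
  induction h with
  | rel x y h =>
    rcases h with h | rfl | ⟨rfl | rfl, rfl | rfl⟩
    · exact Or.inl h
    all_goals simp
  | refl x => exact Or.inl (R.refl' x)
  | symm x y _ ih =>
    rcases ih with h | ⟨h, h'⟩ | ⟨h, h'⟩
    · exact Or.inl (R.symm' h)
    · exact Or.inr (Or.inr ⟨R.symm' h', R.symm' h⟩)
    · exact Or.inr (Or.inl ⟨R.symm' h', R.symm' h⟩)
  | trans x y z _ _ ih ih' =>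
    rcases ih with h | ⟨h, k⟩ | ⟨h, k⟩ <;> rcases ih' with h' | ⟨h', k'⟩ | ⟨h', k'⟩
    · exact Or.inl (R.trans' h h')
    · exact Or.inr (Or.inl ⟨R.trans' h h', k'⟩)
    · exact Or.inr (Or.inr ⟨R.trans' h h', k'⟩)
    · exact Or.inr (Or.inl ⟨h, R.trans' k h'⟩)
    · exact Or.inr (Or.inl ⟨h, k'⟩)
    · exact Or.inl (R.trans' h k')
    · exact Or.inr (Or.inr ⟨h, R.trans' k h'⟩)
    · exact Or.inl (R.trans' h k')
    · exact Or.inr (Or.inr ⟨h, k'⟩)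

theorem covBy_sup_block_pair {R : Setoid V} {i j : V} (hij : ¬ R i j) :
    R ⋖ R ⊔ block {i, j} := by
  refine ⟨left_lt_sup.2 fun h => hij (block_pair_le.1 h), fun W hRW hW => ?_⟩
  obtain ⟨a, b, hab, hab'⟩ : ∃ a b, W a b ∧ ¬ R a b := by
    by_contra! h
    exact hRW.not_ge fun a b hab => h a b hab
  refine hW.not_ge (sup_le hRW.le (block_pair_le.2 ?_))
  have hle : ∀ {x y}, R x y → W x y := fun h => hRW.le h
  rcases sup_block_pair_apply (hW.le hab) with h | ⟨h, k⟩ | ⟨h, k⟩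
  · exact absurd h hab'
  · exact W.trans' (W.trans' (W.symm' (hle h)) hab) (W.symm' (hle k))
  · exact W.trans' (hle k) (W.trans' (W.symm' hab) (hle h))

theorem exists_eq_sup_block_pair {R S : Setoid V} (h : R ⋖ S) :
    ∃ i j, S i j ∧ ¬ R i j ∧ S = R ⊔ block {i, j} := by
  obtain ⟨i, j, hS, hR⟩ : ∃ i j, S i j ∧ ¬ R i j := by
    by_contra! h'
    exact h.lt.not_ge fun a b hab => h' a b hab
  exact ⟨i, j, hS, hR, ((h.eq_or_eq (covBy_sup_block_pair hR).le
    (sup_le h.le (block_pair_le.2 hS))).resolve_left (covBy_sup_block_pair hR).lt.ne').symm⟩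

instance isUpperModularLattice : IsUpperModularLattice (Setoid V) where
  covBy_sup_of_inf_covBy {R S} h := by
    obtain ⟨i, j, hR, hRS, hsup⟩ := exists_eq_sup_block_pair h
    have hS : ¬ S i j := fun hS => hRS (Setoid.inf_iff_and.2 ⟨hR, hS⟩)
    have : R ⊔ S = S ⊔ block {i, j} := by
      conv_lhs => rw [hsup]
      rw [sup_right_comm, sup_eq_right.2 (inf_le_right : R ⊓ S ≤ S)]
    rw [this]
    exact covBy_sup_block_pair hS

theorem isAtom_block_pair {i j : V} (hij : i ≠ j) : IsAtom (block {i, j}) := by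
  have := covBy_sup_block_pair (R := (⊥ : Setoid V)) (i := i) (j := j)
    (by simpa [Setoid.bot_def] using hij)
  rwa [bot_sup_eq, bot_covBy_iff] at this

instance isAtomistic : IsAtomistic (Setoid V) where
  isLUB_atoms R := by
    refine ⟨{A | IsAtom A ∧ A ≤ R}, ⟨fun A hA => hA.2, fun S hS a b hab => ?_⟩, fun A hA => hA.1⟩
    by_cases h : a = b
    · exact h ▸ S.refl' a
    · exact block_pair_le.1 (hS ⟨isAtom_block_pair h, block_pair_le.2 hab⟩)

theorem block_compl_singleton_apply {v a b : V} (ha : a ≠ v) (hb : b ≠ v) :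
    block {v}ᶜ a b := block_apply.2 (Or.inr ⟨ha, hb⟩)

theorem not_block_compl_singleton_apply {v b : V} (hb : b ≠ v) : ¬ block {v}ᶜ v b := by
  rintro (h | h)
  · exact hb h.symm
  · exact h.1 rfl

/-- Splitting off a single point is a coatom of the partition lattice. -/
theorem isCoatom_block_compl_singleton [Nontrivial V] (v : V) :
    IsCoatom (block ({v}ᶜ : Set V)) := by
  obtain ⟨w, hw⟩ := exists_ne v
  refine ⟨fun h => not_block_compl_singleton_apply hw (h ▸ trivial), fun W hW => ?_⟩
  obtain ⟨u, huv, hu⟩ : ∃ u, u ≠ v ∧ W v u := by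
    by_contra! h
    refine hW.not_ge fun a b hab => ?_
    by_cases ha : a = v
    · by_cases hb : b = v
      · rw [ha, hb]
      · exact absurd (ha ▸ hab) (h b hb)
    · by_cases hb : b = v
      · exact absurd (hb ▸ W.symm' hab) (h a ha)
      · exact block_compl_singleton_apply ha hb
  have key : ∀ a, W v a := fun a => by
    by_cases ha : a = v
    · exact ha ▸ W.refl' _
    · exact W.trans' hu (hW.le (block_compl_singleton_apply huv ha))
  exact Setoid.eq_top_iff.2 fun a b => W.trans' (W.symm' (key a)) (key b)

/-- Splitting off a single point is a modular element: to pass inside `S` between `v` and another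
point in the join of `R ≤ S` with it, one has to leave `v` along `R`. -/
theorem isModularElement_block_compl_singleton {V : Type u} (v : V) :
    IsModularElement (block ({v}ᶜ : Set V)) := by
  intro R S hRS
  refine le_antisymm (le_inf (sup_le_sup_left inf_le_left _) (sup_le hRS inf_le_right)) ?_
  have hH : ∀ {a b}, a ≠ v → b ≠ v → S a b → (R ⊔ block {v}ᶜ ⊓ S) a b := fun ha hb h =>
    (le_sup_right : _ ≤ R ⊔ block {v}ᶜ ⊓ S)
      (Setoid.inf_iff_and.2 ⟨block_compl_singleton_apply ha hb, h⟩)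
  have key : ∀ {b}, b ≠ v → S v b → (R ⊔ block {v}ᶜ) v b → (R ⊔ block {v}ᶜ ⊓ S) v b := by
    intro b hb hSb hsup
    obtain ⟨u, huv, hu⟩ : ∃ u, u ≠ v ∧ R v u := by
      by_contra! h
      have hR : R ≤ block {v}ᶜ := fun a c hac => by
        by_cases ha : a = v
        · by_cases hc : c = v
          · rw [ha, hc]
          · exact absurd (ha ▸ hac) (h c hc)
        · by_cases hc : c = v
          · exact absurd (hc ▸ R.symm' hac) (h a ha)
          · exact block_compl_singleton_apply ha hc
      rw [sup_eq_right.2 hR] at hsup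
      exact not_block_compl_singleton_apply hb hsup
    exact Setoid.trans' _ ((le_sup_left : R ≤ _) hu)
      (hH huv hb (S.trans' (S.symm' (hRS hu)) hSb))
  intro a b hab
  obtain ⟨h1, h2⟩ := Setoid.inf_iff_and.1 hab
  by_cases ha : a = v
  · by_cases hb : b = v
    · rw [ha, hb]
    · subst ha; exact key hb h2 h1
  · by_cases hb : b = v
    · subst hb
      exact Setoid.symm' _ (key ha (S.symm' h2) (Setoid.symm' _ h1))
    · exact hH ha hb h2

/-- The partition lattice depends only on the cardinality of the underlying set. -/
def setoidCongr {V W : Type*} (f : V ≃ W) : Setoid V ≃o Setoid W where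
  toFun R := R.comap f.symm
  invFun R := R.comap f
  left_inv R := by ext a b; simp [Setoid.comap_rel]
  right_inv R := by ext a b; simp [Setoid.comap_rel]
  map_rel_iff' {R S} := by
    refine ⟨fun h a b hab => ?_, fun h a b hab => h hab⟩
    have hR : R (f.symm (f a)) (f.symm (f b)) := by simpa only [f.symm_apply_apply] using hab
    have hS : S (f.symm (f a)) (f.symm (f b)) := h hR
    simpa only [f.symm_apply_apply] using hS

theorem encard_covBy_bot (n : ℕ) : {R : Setoid (Fin n) | ⊥ ⋖ R}.encard = n.choose 2 := by
  let f : {z : Sym2 (Fin n) // ¬ z.IsDiag} → Setoid (Fin n) := fun z => block {a | a ∈ z.1}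
  have hmk : ∀ i j : Fin n, {a | a ∈ s(i, j)} = ({i, j} : Set (Fin n)) := fun i j => by
    ext; simp
  have hf : Function.Injective f := by
    rintro ⟨z, hz⟩ ⟨w, hw⟩ h
    induction z with | _ i j
    induction w with | _ k l
    simp only [f, hmk] at h
    have h1 : block {k, l} i j := h ▸ block_apply.2 (Or.inr ⟨by simp, by simp⟩)
    simp only [Sym2.mk_isDiag_iff] at hz
    rw [Subtype.mk.injEq, Sym2.eq_iff]
    rcases h1 with h1 | ⟨rfl | rfl, rfl | rfl⟩ <;> simp_all
  have hr : {R : Setoid (Fin n) | ⊥ ⋖ R} = Set.range f := by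
    ext R
    simp only [Set.mem_ofPred_eq, Set.mem_range]
    constructor
    · intro h
      obtain ⟨i, j, -, hij, hR⟩ := exists_eq_sup_block_pair h
      refine ⟨⟨s(i, j), fun h => hij ?_⟩, ?_⟩
      · rw [Sym2.mk_isDiag_iff.1 h]
      · simp only [f, hmk, hR, bot_sup_eq]
    · rintro ⟨⟨z, hz⟩, rfl⟩
      induction z with | _ i j
      simp only [f, hmk, bot_covBy_iff]
      exact isAtom_block_pair (by simpa using hz)
  rw [hr, ← Set.image_univ, hf.encard_image, Set.encard_univ, ENat.card_eq_coe_fintype_card,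
    Sym2.card_subtype_not_diag, Fintype.card_fin]

theorem coheight_bot (n : ℕ) : Order.coheight (⊥ : Setoid (Fin n)) = (n - 1 : ℕ) := by
  -- The blocks of initial segments form a maximal chain.
  let R : ℕ → Setoid (Fin n) := fun k => block {i | i.1 < k}
  have hcov : ∀ k, 0 < k → k < n → R k ⋖ R (k + 1) := fun k h0 hk => by
    have : R (k + 1) = R k ⊔ block {⟨0, h0.trans hk⟩, ⟨k, hk⟩} := by
      refine le_antisymm ?_ (sup_le ?_ (block_pair_le.2 ?_))
      · have key : ∀ a : Fin n, a.1 < k + 1 →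
            (R k ⊔ block {⟨0, h0.trans hk⟩, ⟨k, hk⟩}) ⟨0, h0.trans hk⟩ a := fun a ha => by
          rcases Nat.lt_succ_iff_lt_or_eq.1 ha with ha | ha
          · exact (le_sup_left : R k ≤ _) (block_apply.2 (Or.inr ⟨h0, ha⟩))
          · exact (le_sup_right : _ ≤ R k ⊔ _) (block_apply.2 (Or.inr ⟨by simp, by simp [← ha]⟩))
        rintro a b (rfl | ⟨ha, hb⟩)
        · exact Setoid.refl' _ _
        · exact Setoid.trans' _ (Setoid.symm' _ (key a ha)) (key b hb)
      · rintro a b (rfl | ⟨ha, hb⟩)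
        · exact Setoid.refl' _ _
        · exact block_apply.2 (Or.inr ⟨Nat.lt_succ_of_lt ha, Nat.lt_succ_of_lt hb⟩)
      · exact block_apply.2 (Or.inr ⟨Nat.succ_pos k, Nat.lt_succ_self k⟩)
    rw [this]
    refine covBy_sup_block_pair ?_
    rintro (h | h)
    · exact h0.ne (congrArg Fin.val h)
    · exact lt_irrefl k h.2
  have htop : R n = ⊤ := Setoid.eq_top_iff.2 fun a b => block_apply.2 (Or.inr ⟨a.2, b.2⟩)
  have hco : ∀ j, ∀ k, 0 < k → k + j = n → Order.coheight (R k) = j := by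
    intro j
    induction j with
    | zero => intro k _ hk; rw [add_zero] at hk; rw [hk, htop]; simp
    | succ j ih =>
      intro k h0 hk
      rw [coheight_eq_of_covBy (hcov k h0 (by omega)), ih (k + 1) (by omega) (by omega)]
      push_cast; rfl
  rcases Nat.eq_zero_or_pos n with rfl | hn
  · rw [(Setoid.eq_top_iff.2 fun a _ => a.elim0 : (⊥ : Setoid (Fin 0)) = ⊤)]; simp
  · rw [← hco (n - 1) 1 one_pos (by omega)]
    congr 1
    refine (eq_bot_iff.2 ?_).symm
    rintro a b (rfl | ⟨ha, hb⟩)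
    · exact Setoid.refl' _ _
    · exact Fin.ext ((Nat.lt_one_iff.1 ha).trans (Nat.lt_one_iff.1 hb).symm)

end PartitionLattice

/-! ### Counting collisions -/

section Counting

open Finset

/-- Counting the collisions of a map whose nonempty fibres have at most two elements. -/
theorem card_collisions {α β : Type*} [DecidableEq α] [DecidableEq β] (A : Finset α) (f : α → β)
    (h : ∀ b ∈ A.image f, #{a ∈ A | f a = b} ≤ 2) :
    #{x ∈ A.offDiag | f x.1 = f x.2} + 2 * #(A.image f) = 2 * #A ∧ #A ≤ 2 * #(A.image f) := by
  have hA : #A = ∑ b ∈ A.image f, #{a ∈ A | f a = b} :=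
    card_eq_sum_card_fiberwise fun a ha => mem_image_of_mem f ha
  have hC : #{x ∈ A.offDiag | f x.1 = f x.2} =
      ∑ b ∈ A.image f, #{x ∈ {x ∈ A.offDiag | f x.1 = f x.2} | f x.1 = b} :=
    card_eq_sum_card_fiberwise fun x hx =>
      mem_image_of_mem f (mem_offDiag.1 (mem_filter.1 hx).1).1
  have hfib : ∀ b, #{x ∈ {x ∈ A.offDiag | f x.1 = f x.2} | f x.1 = b} =
      #{a ∈ A | f a = b} * #{a ∈ A | f a = b} - #{a ∈ A | f a = b} := fun b => by
    rw [← offDiag_card]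
    congr 1
    ext x
    simp only [mem_filter, mem_offDiag]
    constructor
    · rintro ⟨⟨⟨h1, h2, h3⟩, h4⟩, h5⟩; exact ⟨⟨h1, h5⟩, ⟨h2, h4 ▸ h5⟩, h3⟩
    · rintro ⟨⟨h1, h5⟩, ⟨h2, h6⟩, h3⟩; exact ⟨⟨⟨h1, h2, h3⟩, h5.trans h6.symm⟩, h5⟩
  have hpos : ∀ b ∈ A.image f, 0 < #{a ∈ A | f a = b} := fun b hb => by
    obtain ⟨a, ha, hab⟩ := mem_image.1 hb
    exact card_pos.2 ⟨a, mem_filter.2 ⟨ha, hab⟩⟩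
  constructor
  · rw [hC, hA, card_eq_sum_ones, mul_sum, mul_sum, ← sum_add_distrib]
    refine sum_congr rfl fun b hb => ?_
    rw [hfib]
    have h1 := hpos b hb
    have h2 := h b hb
    interval_cases #{a ∈ A | f a = b} <;> rfl
  · rw [hA, card_eq_sum_ones, mul_sum]
    exact sum_le_sum fun b hb => h b hb

end Counting

/-! ### Upper intervals of geometric lattices -/

section SemimodularLattice

theorem covBy_sup_of_covBy_of_not_le {G : Type*} [Lattice G] [IsUpperModularLattice G]
    {y p w : G} (hp : y ⋖ p) (hw : y ≤ w) (hpw : ¬ p ≤ w) :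
    w ⋖ w ⊔ p := by
  refine covBy_sup_of_inf_covBy_right (a := w) (b := p) ?_
  rwa [(hp.eq_or_eq (le_inf hw hp.le) inf_le_right).resolve_right fun h => hpw (inf_eq_right.1 h)]

/-- The rank of the interval from `y` to the top. -/
noncomputable def corank {G : Type*} [Preorder G] (y : G) : ℕ := (Order.coheight y).toNat

theorem corank_top {G : Type*} [Preorder G] [OrderTop G] : corank (⊤ : G) = 0 := by
  simp [corank]

variable {G : Type*} [Lattice G] [BoundedOrder G] [IsUpperModularLattice G]

/-- Upper intervals of a geometric lattice are atomistic. -/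
theorem exists_covBy_le_not_le [IsAtomistic G] {y z w : G} (hyz : y ≤ z) (hyw : y ≤ w)
    (hzw : ¬ z ≤ w) : ∃ p, y ⋖ p ∧ p ≤ z ∧ ¬ p ≤ w := by
  obtain ⟨s, hs, hatom⟩ := IsAtomistic.isLUB_atoms z
  obtain ⟨a, ha, haw⟩ : ∃ a ∈ s, ¬ a ≤ w := by
    by_contra! h
    exact hzw (hs.2 h)
  refine ⟨y ⊔ a, covBy_sup_of_covBy_of_not_le (bot_covBy_iff.2 (hatom a ha)) bot_le
    fun h => haw (h.trans hyw), sup_le hyz (hs.1 ha), fun h => haw (le_sup_right.trans h)⟩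

theorem coe_corank [Finite G] (y : G) : (corank y : ℕ∞) = Order.coheight y := by
  refine ENat.natCast_toNat ?_
  induction y using WellFoundedGT.induction with
  | ind y ih =>
    by_cases hy : y = ⊤
    · simp [hy]
    · obtain ⟨z, hz, -⟩ := exists_covBy_le_of_lt (lt_top_iff_ne_top.2 hy)
      rw [coheight_eq_of_covBy hz]
      rw [← ENat.natCast_toNat (ih z hz.lt)]
      exact ENat.natCast_ne_top (_ + 1)

theorem corank_eq_of_covBy [Finite G] {y z : G} (h : y ⋖ z) : corank y = corank z + 1 := by
  have := coheight_eq_of_covBy h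
  rw [← coe_corank, ← coe_corank] at this
  exact_mod_cast this

/-- Joining with an atom lowers the corank by at most one. -/
theorem corank_le_corank_sup_finset [Finite G] {ι : Type*} (s : Finset ι) (w : ι → G)
    (hw : ∀ i, ⊥ ⩿ w i) : corank (⊥ : G) ≤ corank (s.sup w) + s.card := by
  classical
  induction s using Finset.induction_on with
  | empty => simp
  | insert i s hi ih =>
    rw [Finset.sup_insert, Finset.card_insert_of_notMem hi]
    by_cases h : w i ≤ s.sup w
    · rw [sup_eq_right.2 h]; omega
    · have hbot : ⊥ ⋖ w i := (hw i).covBy_of_ne fun h0 => h (h0 ▸ bot_le)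
      have := corank_eq_of_covBy (covBy_sup_of_covBy_of_not_le hbot bot_le h)
      rw [sup_comm]; omega

/-- If every corank-two element has at most three covers, then every interval of length two has
at most three atoms: joining with an atom outside the interval moves it up injectively. -/
theorem ncard_covBy_le_three [Finite G] [IsAtomistic G]
    (h2 : ∀ y : G, corank y = 2 → {t | y ⋖ t}.ncard ≤ 3)
    {y a z : G} (ha : y ⋖ a) (hz : a ⋖ z) : {t | y ⋖ t ∧ t ≤ z}.ncard ≤ 3 := by
  induction y using WellFoundedGT.induction generalizing a z with
  | ind y ih =>
    have hyz := ha.le.trans hz.le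
    by_cases htop : z = ⊤
    · subst htop
      simp only [le_top, and_true]
      apply h2
      rw [corank_eq_of_covBy ha, corank_eq_of_covBy hz, corank_top]
    · obtain ⟨t, ht, -, htz⟩ := exists_covBy_le_not_le (le_top : y ≤ ⊤) hyz
        (fun h => htop (top_le_iff.1 h))
      have key : ∀ {b}, b ≤ z → y ≤ b → b ⋖ b ⊔ t := fun hb hyb =>
        covBy_sup_of_covBy_of_not_le ht hyb fun h => htz (h.trans hb)
      have key' : ∀ {b}, y ⋖ b → b ≤ z → t ⋖ b ⊔ t := fun {b} hb hbz => by
        rw [sup_comm]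
        exact covBy_sup_of_covBy_of_not_le hb ht.le
          fun h => htz ((ht.eq_or_eq hb.le h).resolve_left hb.lt.ne' ▸ hbz)
      have htop' : a ⊔ t ⋖ z ⊔ t := by
        have h := covBy_sup_of_covBy_of_not_le hz (le_sup_left : a ≤ a ⊔ t) fun h =>
          htz ((key hz.le ha.le).eq_or_eq hz.le h |>.resolve_left hz.lt.ne' ▸ le_sup_right)
        rwa [sup_right_comm, sup_eq_right.2 hz.le] at h
      refine le_trans (Set.ncard_le_ncard_of_injOn (· ⊔ t) ?_ ?_ (Set.toFinite _))
        (ih t ht.lt (key' ha hz.le) htop')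
      · rintro b ⟨hb, hbz⟩
        exact ⟨key' hb hbz, sup_le_sup_right hbz t⟩
      · rintro b ⟨hb, hbz⟩ c ⟨hc, hcz⟩ (hbc : b ⊔ t = c ⊔ t)
        by_contra hne
        have hcb : ¬ c ≤ b := fun h =>
          hne ((hb.eq_or_eq hc.le h).resolve_left hc.lt.ne').symm
        have := (key hbz hb.le).eq_or_eq (le_sup_left : b ≤ b ⊔ c)
          (sup_le le_sup_left (hbc ▸ le_sup_left))
        rcases this with h | h
        · exact hcb (h ▸ le_sup_right)
        · exact htz ((h ▸ le_sup_right : t ≤ b ⊔ c).trans (sup_le hbz hcz))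

end SemimodularLattice

/-! ### Recognizing a partition lattice by a labelling of its atoms -/

section Labelling

variable {G : Type*} [Lattice G] [BoundedOrder G] [IsUpperModularLattice G] [Finite G]
  [IsAtomistic G]

/-- A geometric lattice of rank `n - 1` whose atoms are indexed by the pairs of an `n`-element set
in such a way that triangles are dependent is a partition lattice. -/
theorem nonempty_orderIso_setoid {V : Type*} [Fintype V] (e : V → V → G)
    (hself : ∀ i, e i i = ⊥) (hsymm : ∀ i j, e i j = e j i)
    (htri : ∀ i j k, e i k ≤ e i j ⊔ e j k) (hcov : ∀ i j, ⊥ ⩿ e i j)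
    (hsurj : ∀ a, IsAtom a → ∃ i j, e i j = a)
    (hcard : corank (⊥ : G) + 1 = Fintype.card V) : Nonempty (G ≃o Setoid V) := by
  classical
  let φ : G → Setoid V := fun x =>
    { r := fun i j => e i j ≤ x
      iseqv := ⟨fun i => by simp [hself], fun {i j} h => hsymm i j ▸ h,
        fun {i j k} h h' => (htri i j k).trans (sup_le h h')⟩ }
  have hφ : ∀ {x y}, φ x ≤ φ y ↔ x ≤ y := by
    intro x y
    refine ⟨fun h => ?_, fun h i j hij => le_trans hij h⟩
    obtain ⟨s, hs, hatom⟩ := IsAtomistic.isLUB_atoms x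
    refine hs.2 fun a ha => ?_
    obtain ⟨i, j, rfl⟩ := hsurj a (hatom a ha)
    exact h (show e i j ≤ x from hs.1 ha)
  have hφsurj : Function.Surjective φ := by
    intro R
    let x : G := (Finset.univ.filter fun p : V × V => R p.1 p.2).sup fun p => e p.1 p.2
    refine ⟨x, le_antisymm (fun k l hkl => ?_) fun i j hij => Finset.le_sup (f := fun p : V × V =>
      e p.1 p.2) (Finset.mem_filter.2 ⟨Finset.mem_univ (i, j), hij⟩)⟩
    replace hkl : e k l ≤ x := hkl
    by_contra hR
    -- A star at `k` inside the class of `k`, and a star at `l` outside of it: the join of these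
    -- `card V - 2` atoms cannot be the top.
    let w : V → G := fun i => if R k i then e k i else e l i
    let s : Finset V := (Finset.univ.erase k).erase l
    have hw : ∀ i, w i ≤ s.sup w := fun i => by
      by_cases hk : i = k
      · simp [w, hk, hself]
      · by_cases hl : i = l
        · simp [w, hl, hself, hR]
        · exact Finset.le_sup (f := w) (by simp [s, hk, hl])
    have hx : x ≤ s.sup w := by
      refine Finset.sup_le fun p hp => ?_
      have hp' : R p.1 p.2 := (Finset.mem_filter.1 hp).2
      by_cases h : R k p.1
      · have h' : R k p.2 := R.trans' h hp'
        have h1 := hw p.1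
        have h2 := hw p.2
        simp only [w, h, h', if_true] at h1 h2
        exact (htri p.1 k p.2).trans (sup_le (hsymm k p.1 ▸ h1) h2)
      · have h' : ¬ R k p.2 := fun h' => h (R.trans' h' (R.symm' hp'))
        have h1 := hw p.1
        have h2 := hw p.2
        simp only [w, h, h', if_false] at h1 h2
        exact (htri p.1 l p.2).trans (sup_le (hsymm l p.1 ▸ h1) h2)
    have hki : ∀ i, e k i ≤ s.sup w := fun i => by
      have h1 := hw i
      by_cases h : R k i
      · simpa only [w, h, if_true] using h1
      · simp only [w, h, if_false] at h1
        exact (htri k l i).trans (sup_le (hkl.trans hx) h1)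
    have htop : s.sup w = ⊤ := by
      obtain ⟨t, ht, hatom⟩ := IsAtomistic.isLUB_atoms (⊤ : G)
      refine top_le_iff.1 (ht.2 fun a ha => ?_)
      obtain ⟨i, j, rfl⟩ := hsurj a (hatom a ha)
      exact (htri i k j).trans (sup_le (hsymm k i ▸ hki i) (hki j))
    have hle := corank_le_corank_sup_finset s w fun i => by
      by_cases h : R k i
      · simpa only [w, h, if_true] using hcov k i
      · simpa only [w, h, if_false] using hcov l i
    have hlk : l ≠ k := fun h => hR (h ▸ R.refl' k)
    have hs : s.card = Fintype.card V - 1 - 1 := by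
      rw [Finset.card_erase_of_mem (by simp [hlk]), Finset.card_erase_of_mem (by simp),
        Finset.card_univ]
    have h1 : 1 < Fintype.card V := Fintype.one_lt_card_iff.2 ⟨l, k, hlk⟩
    rw [htop, corank_top, hs] at hle
    omega
  exact ⟨RelIso.ofSurjective (OrderEmbedding.ofMapLEIff φ fun _ _ => hφ) hφsurj⟩

end Labelling

/-! ### Modular coatoms -/

section ModularCoatom

/-- Together with `IsModularCoatomAbove.inf_sup_eq`, this makes the intervals `[y, H]` and `[p, ⊤]`
isomorphic. -/
theorem sup_inf_eq_of_covBy {G : Type*} [Lattice G] [IsUpperModularLattice G] {y H p w : G}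
    (hp : y ⋖ p) (hpH : ¬ p ≤ H) (hw : y ≤ w) (hwH : w ≤ H) : (w ⊔ p) ⊓ H = w :=
  ((covBy_sup_of_covBy_of_not_le hp hw fun h => hpH (h.trans hwH)).eq_or_eq
    (le_inf le_sup_left hwH) inf_le_left).resolve_right fun h =>
      hpH (le_sup_right.trans (inf_eq_left.1 h))

variable {G : Type*} [Lattice G] [BoundedOrder G]

/-- `H` is a coatom above `y` that is a modular element of the interval from `y` to the top. -/
structure IsModularCoatomAbove (y H : G) : Prop where
  le : y ≤ H
  isCoatom : IsCoatom H
  modular : ∀ a b : G, y ≤ a → a ≤ b → a ⊔ (H ⊓ b) = (a ⊔ H) ⊓ b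

namespace IsModularCoatomAbove

variable {y H : G}

theorem mono (h : IsModularCoatomAbove y H) {z : G} (hyz : y ≤ z) (hz : z ≤ H) :
    IsModularCoatomAbove z H :=
  ⟨hz, h.isCoatom, fun a b ha hab => h.modular a b (hyz.trans ha) hab⟩

/-- Modularity makes `z ↦ z ⊓ H` injective on the interval `[p, ⊤]`, with inverse `t ↦ t ⊔ p`. -/
theorem inf_sup_eq (h : IsModularCoatomAbove y H) {p z : G} (hp : y ≤ p) (hpH : ¬ p ≤ H)
    (hz : p ≤ z) : z ⊓ H ⊔ p = z := by
  have htop : p ⊔ H = ⊤ := h.isCoatom.2 _ (right_lt_sup.2 hpH)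
  rw [sup_comm, inf_comm, h.modular p z hp hz, htop, top_inf_eq]

variable [IsUpperModularLattice G]

theorem covBy_inf (h : IsModularCoatomAbove y H) {p z : G} (hp : y ⋖ p) (hpH : ¬ p ≤ H)
    (hz : p ⋖ z) : y ⋖ z ⊓ H := by
  have hE := h.inf_sup_eq hp.le hpH hz.le
  refine ⟨lt_of_le_of_ne (le_inf (hp.le.trans hz.le) h.le) fun h0 => ?_, fun w hyw hwz => ?_⟩
  · rw [← h0, sup_eq_right.2 hp.le] at hE
    exact hz.lt.ne hE
  · have hwH : w ≤ H := hwz.le.trans inf_le_right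
    have hD := sup_inf_eq_of_covBy hp hpH hyw.le hwH
    rcases hz.eq_or_eq (le_sup_right : p ≤ w ⊔ p)
      (sup_le (hwz.le.trans inf_le_left) hz.le) with h1 | h1
    · refine hpH ?_
      have hw : w ≤ p := h1 ▸ le_sup_left
      exact ((hp.eq_or_eq hyw.le hw).resolve_left hyw.ne') ▸ hwH
    · exact hwz.ne (h1 ▸ hD).symm

/-- The interval below a modular coatom is perspective to the interval above a complement. -/
theorem ncard_covBy_le (h : IsModularCoatomAbove y H) {p : G} (hp : y ⋖ p) (hpH : ¬ p ≤ H) :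
    {t | y ⋖ t ∧ t ≤ H}.ncard = {z | p ⋖ z}.ncard := by
  refine Set.ncard_congr (fun t _ => t ⊔ p) ?_ ?_ ?_
  · rintro t ⟨ht, htH⟩
    rw [Set.mem_ofPred_eq, sup_comm]
    exact covBy_sup_of_covBy_of_not_le ht hp.le fun htp =>
      hpH ((hp.eq_or_eq ht.le htp).resolve_left ht.lt.ne' ▸ htH)
  · rintro a b ⟨ha, haH⟩ ⟨hb, hbH⟩ (hab : a ⊔ p = b ⊔ p)
    rw [← sup_inf_eq_of_covBy hp hpH ha.le haH, hab, sup_inf_eq_of_covBy hp hpH hb.le hbH]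
  · intro z hz
    exact ⟨z ⊓ H, ⟨h.covBy_inf hp hpH hz, inf_le_right⟩, h.inf_sup_eq hp.le hpH (CovBy.le hz)⟩

/-- Two covers of `y` off a modular coatom have the same join with `s` exactly if `s` is the
point where the line through them meets the coatom. -/
theorem sup_eq_sup_iff (h : IsModularCoatomAbove y H) {s p q : G} (hs : y ⋖ s) (hsH : s ≤ H)
    (hp : y ⋖ p) (hpH : ¬ p ≤ H) (hq : y ⋖ q) (hqH : ¬ q ≤ H) (hpq : p ≠ q) :
    p ⊔ s = q ⊔ s ↔ (p ⊔ q) ⊓ H = s := by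
  have hqp : ¬ q ≤ p := fun hqp => hpq ((hp.eq_or_eq hq.le hqp).resolve_left hq.lt.ne').symm
  have hcov : p ⋖ p ⊔ q := covBy_sup_of_covBy_of_not_le hq hp.le hqp
  have hcov' : p ⋖ p ⊔ s := covBy_sup_of_covBy_of_not_le hs hp.le fun hsp =>
    hpH ((hp.eq_or_eq hs.le hsp).resolve_left hs.lt.ne' ▸ hsH)
  constructor
  · intro heq
    have h1 : p ⊔ q = p ⊔ s := (hcov'.eq_or_eq le_sup_left
      (sup_le le_sup_left (heq ▸ le_sup_left))).resolve_left hcov.lt.ne'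
    rw [h1, sup_comm, sup_inf_eq_of_covBy hp hpH hs.le hsH]
  · rintro rfl
    rw [sup_comm p, sup_comm q, h.inf_sup_eq hp.le hpH le_sup_left,
      h.inf_sup_eq hq.le hqH le_sup_right]

theorem exists_covBy_not_le [IsAtomistic G] (h : IsModularCoatomAbove y H) :
    ∃ p, y ⋖ p ∧ ¬ p ≤ H := by
  obtain ⟨p, hp, -, hpH⟩ := exists_covBy_le_not_le (le_top : y ≤ ⊤) h.le
    fun ht => h.isCoatom.1 (top_le_iff.1 ht)
  exact ⟨p, hp, hpH⟩

/-- The lines through `s` off `H` are the lines that join `s` to an atom off `H`. -/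
theorem image_sup_eq [IsAtomistic G] (h : IsModularCoatomAbove y H) {s : G} (hs : y ⋖ s)
    (hsH : s ≤ H) : (fun p => p ⊔ s) '' {t | y ⋖ t ∧ ¬ t ≤ H} = {t | s ⋖ t ∧ ¬ t ≤ H} := by
  ext z
  simp only [Set.mem_image, Set.mem_ofPred_eq]
  constructor
  · rintro ⟨p, ⟨hp, hpH⟩, rfl⟩
    refine ⟨?_, fun hz => hpH (le_sup_left.trans hz)⟩
    rw [sup_comm]
    exact covBy_sup_of_covBy_of_not_le hp hs.le fun hps => hpH (hps.trans hsH)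
  · rintro ⟨hz, hzH⟩
    obtain ⟨p, hp, hpz, hpH⟩ := exists_covBy_le_not_le (hs.le.trans hz.le) h.le hzH
    refine ⟨p, ⟨hp, hpH⟩, (hz.eq_or_eq le_sup_right (sup_le hpz hz.le)).resolve_left fun h0 => ?_⟩
    exact hpH ((h0 ▸ le_sup_left : p ≤ s).trans hsH)

variable [Finite G]

theorem ncard_covBy (h : IsModularCoatomAbove y H) {p : G} (hp : y ⋖ p) (hpH : ¬ p ≤ H) :
    {t | y ⋖ t}.ncard = {t | y ⋖ t ∧ ¬ t ≤ H}.ncard + {z | p ⋖ z}.ncard := by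
  rw [← h.ncard_covBy_le hp hpH, ← Set.ncard_union_eq ?_ (Set.toFinite _) (Set.toFinite _)]
  · congr 1; ext t; simp only [Set.mem_union, Set.mem_ofPred_eq]; tauto
  · exact Set.disjoint_left.2 fun t h1 h2 => h1.2 h2.2

/-- Each cover of `y` below a modular coatom has as many covers off the coatom as a partition
lattice would have. -/
theorem ncard_covBy_not_le (h : IsModularCoatomAbove y H)
    (hN : ∀ z, y < z → {t | z ⋖ t}.ncard = (corank z + 1).choose 2)
    {p : G} (hp : y ⋖ p) (hpH : ¬ p ≤ H) {s : G} (hs : y ⋖ s) (hsH : s ≤ H) :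
    {t | s ⋖ t ∧ ¬ t ≤ H}.ncard + 1 = corank y := by
  have hq : s ⋖ s ⊔ p := covBy_sup_of_covBy_of_not_le hp hs.le fun hps => hpH (hps.trans hsH)
  have hqH : ¬ s ⊔ p ≤ H := fun hq => hpH (le_sup_right.trans hq)
  have h1 := (h.mono hs.le hsH).ncard_covBy hq hqH
  rw [hN s hs.lt, hN _ (hs.lt.trans hq.lt), corank_eq_of_covBy hq,
    Nat.choose_succ_succ' _ 1, Nat.choose_one_right, one_add_one_eq_two] at h1
  rw [corank_eq_of_covBy hs, corank_eq_of_covBy hq]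
  omega

end IsModularCoatomAbove

end ModularCoatom

/-! ### The number of atoms, and the identification of the lattice -/

section Counts

variable {G : Type*} [Lattice G] [BoundedOrder G] [IsUpperModularLattice G] [Finite G]
  [IsAtomistic G]

/-- The factorization `(m - (c + 1)) * (m - c ^ 2) = 0` behind the count of the atoms off a modular
coatom. -/
theorem eq_succ_of_collision_count {m c k : ℕ} (hc : 3 ≤ c) (hm : m ≤ 2 * c)
    (hk : k + 2 * c = 2 * m) (h : m * m - m = (c + 1).choose 2 * k) : m = c + 1 := by
  have hC : (c + 1) * c = (c + 1).choose 2 * 2 := by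
    simpa using Nat.add_one_mul_choose_eq c 1
  have h' : m * m = (c + 1).choose 2 * k + m := by
    have := Nat.le_mul_self m
    omega
  zify at hC h' hk hm hc ⊢
  have hk' : (k : ℤ) = 2 * m - 2 * c := by linarith
  rw [hk'] at h'
  have hfac : ((m : ℤ) - (c + 1)) * (m - c ^ 2) = 0 := by
    linear_combination h' - (m - c : ℤ) * hC
  rcases mul_eq_zero.1 hfac with h0 | h0
  · linarith
  · nlinarith

/-- If every upper interval has a modular coatom and those of rank at most three have as many atoms
as a partition lattice, then so have all upper intervals. The pairs of distinct covers of `y` off a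
modular coatom `H` are counted by the cover of `y` below `H` that lies on their line. -/
theorem ncard_covBy_eq_choose (hM : ∀ y : G, y ≠ ⊤ → ∃ H, IsModularCoatomAbove y H)
    (hN : ∀ y : G, corank y ≤ 3 → {t | y ⋖ t}.ncard = (corank y + 1).choose 2) (y : G) :
    {t | y ⋖ t}.ncard = (corank y + 1).choose 2 := by
  classical
  induction y using WellFoundedGT.induction with
  | ind y ih =>
    by_cases hr : corank y ≤ 3
    · exact hN y hr
    have hline : ∀ {y a z : G}, y ⋖ a → a ⋖ z → {t | y ⋖ t ∧ t ≤ z}.ncard ≤ 3 :=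
      ncard_covBy_le_three fun y hy => by rw [hN y (by omega), hy]; decide
    obtain ⟨H, h⟩ := hM y fun hy => hr (by rw [hy, corank_top]; omega)
    obtain ⟨p, hp, hpH⟩ := h.exists_covBy_not_le
    obtain ⟨c, hc⟩ : ∃ c, corank y = c + 1 := ⟨_, corank_eq_of_covBy hp⟩
    have hpc : corank p = c := by have := corank_eq_of_covBy hp; omega
    let A : Finset G := {t | y ⋖ t ∧ ¬ t ≤ H}.toFinite.toFinset
    let S : Finset G := {t | y ⋖ t ∧ t ≤ H}.toFinite.toFinset
    have hAmem : ∀ {t}, t ∈ A ↔ y ⋖ t ∧ ¬ t ≤ H := by simp [A]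
    have hSmem : ∀ {t}, t ∈ S ↔ y ⋖ t ∧ t ≤ H := by simp [S]
    have hA : {t | y ⋖ t ∧ ¬ t ≤ H}.ncard = A.card := Set.ncard_eq_toFinset_card _ _
    have hS : S.card = (c + 1).choose 2 := by
      rw [← hpc, ← ih p hp.lt, ← h.ncard_covBy_le hp hpH]
      exact (Set.ncard_eq_toFinset_card _ _).symm
    have htot := h.ncard_covBy hp hpH
    rw [ih p hp.lt, hpc, hA] at htot
    have hs : ∀ s ∈ S, (A.offDiag.filter fun x => (x.1 ⊔ x.2) ⊓ H = s).card + 2 * c = 2 * A.card ∧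
        A.card ≤ 2 * c := by
      intro s hs
      obtain ⟨hys, hsH⟩ := hSmem.1 hs
      have himg : (A.image fun p => p ⊔ s).card = c := by
        have h1 := h.ncard_covBy_not_le ih hp hpH hys hsH
        rw [← h.image_sup_eq hys hsH] at h1
        have h2 : ((fun p => p ⊔ s) '' {t | y ⋖ t ∧ ¬ t ≤ H}) =
            (A.image fun p => p ⊔ s : Finset G) := by
          simp [A]
        rw [h2, Set.ncard_coe_finset] at h1
        omega
      have hcol := card_collisions A (fun p => p ⊔ s) (by
        intro b hb
        -- The fibre together with `s` lies on the line `b`.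
        obtain ⟨a, ha, rfl⟩ := Finset.mem_image.1 hb
        obtain ⟨hya, haH⟩ := hAmem.1 ha
        have hsa : s ⋖ s ⊔ a := covBy_sup_of_covBy_of_not_le hya hys.le fun h => haH (h.trans hsH)
        have h3 := hline hys hsa
        have hsub : (↑(insert s {x ∈ A | x ⊔ s = a ⊔ s}) : Set G) ⊆
            {t | y ⋖ t ∧ t ≤ s ⊔ a} := by
          intro x hx
          rcases Finset.mem_insert.1 (Finset.mem_coe.1 hx) with rfl | hx
          · exact ⟨hys, le_sup_left⟩
          · obtain ⟨hx, hxs⟩ := Finset.mem_filter.1 hx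
            exact ⟨(hAmem.1 hx).1, by rw [sup_comm, ← hxs]; exact le_sup_left⟩
        have h4 := (Set.ncard_le_ncard hsub (Set.toFinite _)).trans h3
        rw [Set.ncard_coe_finset, Finset.card_insert_of_notMem fun hs' =>
          (hAmem.1 (Finset.mem_filter.1 hs').1).2 hsH] at h4
        omega)
      rw [himg] at hcol
      refine ⟨?_, hcol.2⟩
      rw [← hcol.1]
      congr 2
      refine Finset.filter_congr fun x hx => ?_
      obtain ⟨h1, h2, h3⟩ := Finset.mem_offDiag.1 hx
      rw [hAmem] at h1 h2
      exact (h.sup_eq_sup_iff hys hsH h1.1 h1.2 h2.1 h2.2 h3).symm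
    have hoff : A.card * A.card - A.card = S.card * (2 * A.card - 2 * c) := by
      rw [← Finset.offDiag_card, ← smul_eq_mul, ← Finset.sum_const,
        Finset.card_eq_sum_card_fiberwise (f := fun x => (x.1 ⊔ x.2) ⊓ H) (t := S)]
      · refine Finset.sum_congr rfl fun s hsS => ?_
        have := (hs s hsS).1
        omega
      · intro x hx
        obtain ⟨h1, h2, h3⟩ := Finset.mem_offDiag.1 (Finset.mem_coe.1 hx)
        rw [hAmem] at h1 h2
        refine Finset.mem_coe.2 (hSmem.2 ⟨h.covBy_inf h1.1 h1.2 ?_, inf_le_right⟩)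
        exact covBy_sup_of_covBy_of_not_le h2.1 h1.1.le fun hle =>
          h3 ((h1.1.eq_or_eq h2.1.le hle).resolve_left h2.1.lt.ne').symm
    obtain ⟨s, hsS⟩ : S.Nonempty := by
      rw [← Finset.card_pos, hS]
      exact Nat.choose_pos (by omega)
    obtain ⟨hs1, hs2⟩ := hs s hsS
    have hm : A.card = c + 1 :=
      eq_succ_of_collision_count (by omega) hs2 (by omega) (hS ▸ hoff)
    rw [htot, hm, hc, Nat.choose_succ_succ' (c + 1) 1, Nat.choose_one_right]

/-- A geometric lattice in which every upper interval has a modular coatom, and those of rank at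
most three have as many atoms as a partition lattice, is a partition lattice. The points of the
underlying set are the atoms off a modular coatom `H` and one more point; the pair `{p, q}` of
atoms is the atom where the line through `p` and `q` meets `H`. -/
theorem exists_orderIso_setoid_fin (hM : ∀ y : G, y ≠ ⊤ → ∃ H, IsModularCoatomAbove y H)
    (hN3 : ∀ y : G, corank y ≤ 3 → {t | y ⋖ t}.ncard = (corank y + 1).choose 2) :
    ∃ n : ℕ, Nonempty (G ≃o Setoid (Fin n)) := by
  classical
  have hN := ncard_covBy_eq_choose hM hN3
  by_cases hbot : (⊥ : G) = ⊤
  · refine ⟨1, nonempty_orderIso_setoid (fun _ _ => ⊥) (by simp) (by simp) (by simp) (by simp)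
      (fun a ha => ?_) (by rw [hbot, corank_top]; rfl)⟩
    exact absurd (le_top.trans hbot.ge) ha.bot_lt.not_ge
  obtain ⟨H, h⟩ := hM ⊥ hbot
  obtain ⟨p₀, hp₀, hp₀H⟩ := h.exists_covBy_not_le
  obtain ⟨c, hc⟩ : ∃ c, corank (⊥ : G) = c + 1 := ⟨_, corank_eq_of_covBy hp₀⟩
  have hpc : corank p₀ = c := by have := corank_eq_of_covBy hp₀; omega
  have hA : {t | ⊥ ⋖ t ∧ ¬ t ≤ H}.ncard = c + 1 := by
    have htot := h.ncard_covBy hp₀ hp₀H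
    rw [hN, hN, hpc, hc, Nat.choose_succ_succ' (c + 1) 1, Nat.choose_one_right,
      one_add_one_eq_two] at htot
    omega
  let A := {t | ⊥ ⋖ t ∧ ¬ t ≤ H}
  let _ : Fintype A := Fintype.ofFinite A
  have hne : ∀ {p q : A}, p ≠ q → ¬ q.1 ≤ p.1 := fun {p q} hpq hle =>
    hpq (Subtype.ext ((p.2.1.eq_or_eq q.2.1.le hle).resolve_left q.2.1.lt.ne').symm)
  let e : Option A → Option A → G := fun i j =>
    match i, j with
    | none, none => ⊥
    | none, some p => p
    | some p, none => p
    | some p, some q => (p.1 ⊔ q.1) ⊓ H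
  have hdiag : ∀ p : A, (p.1 ⊔ p.1) ⊓ H = ⊥ := fun p => by
    have := sup_inf_eq_of_covBy p.2.1 p.2.2 le_rfl bot_le
    rwa [sup_idem, ← bot_sup_eq p.1]
  have hE : ∀ p q : A, (p.1 ⊔ q.1) ⊓ H ⊔ p.1 = p.1 ⊔ q.1 := fun p q =>
    h.inf_sup_eq bot_le p.2.2 le_sup_left
  have hE' : ∀ p q : A, (p.1 ⊔ q.1) ⊓ H ⊔ q.1 = p.1 ⊔ q.1 := fun p q =>
    h.inf_sup_eq bot_le q.2.2 le_sup_right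
  obtain ⟨f⟩ := nonempty_orderIso_setoid (V := Option A) e
    (by
      rintro (_ | p)
      · rfl
      · exact hdiag p)
    (by
      rintro (_ | p) (_ | q)
      iterate 3 rfl
      exact congrArg (· ⊓ H) (sup_comm _ _))
    (by
      rintro (_ | p) (_ | q) (_ | w)
      · exact bot_le
      · exact le_sup_right
      · exact bot_le
      · exact le_sup_right.trans ((hE q w).ge.trans (sup_comm _ _).le)
      · exact le_sup_left
      · exact inf_le_left
      · exact le_sup_left.trans (hE' p q).ge
      · have hX : (p.1 ⊔ q.1) ⊓ H ⊔ (q.1 ⊔ w.1) ⊓ H ≤ H := sup_le inf_le_right inf_le_right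
        have hD := sup_inf_eq_of_covBy q.2.1 q.2.2 bot_le hX
        refine le_trans (inf_le_inf_right H (sup_le ?_ ?_)) hD.le
        · exact (le_sup_left.trans (hE' p q).ge).trans (sup_le_sup_right le_sup_left _)
        · exact (le_sup_right.trans (hE q w).ge).trans (sup_le_sup_right le_sup_right _))
    (by
      rintro (_ | p) (_ | q)
      · exact WCovBy.refl _
      · exact q.2.1.wcovBy
      · exact p.2.1.wcovBy
      · by_cases hpq : p = q
        · subst hpq
          exact (hdiag p).symm ▸ WCovBy.refl _
        · exact (h.covBy_inf p.2.1 p.2.2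
            (covBy_sup_of_covBy_of_not_le q.2.1 bot_le (hne hpq))).wcovBy)
    (by
      intro s hs
      replace hs := bot_covBy_iff.2 hs
      by_cases hsH : s ≤ H
      · -- There are fewer lines through `s` off `H` than atoms off `H`.
        have hlt : ((fun p => p ⊔ s) '' A).ncard < A.ncard := by
          have := h.ncard_covBy_not_le (fun z _ => hN z) hp₀ hp₀H hs hsH
          rw [h.image_sup_eq hs hsH]
          change _ < {t | ⊥ ⋖ t ∧ ¬ t ≤ H}.ncard
          omega
        obtain ⟨p, hp, q, hq, hpq, heq⟩ := Set.exists_ne_map_eq_of_ncard_lt_of_maps_to hlt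
          (Set.mapsTo_image _ _) (Set.toFinite _)
        exact ⟨some ⟨p, hp⟩, some ⟨q, hq⟩,
          (h.sup_eq_sup_iff hs hsH hp.1 hp.2 hq.1 hq.2 hpq).1 heq⟩
      · exact ⟨none, some ⟨s, hs, hsH⟩, rfl⟩)
    (by
      have : Fintype.card A = c + 1 := by
        rw [← hA, Fintype.card_eq_nat_card]; rfl
      rw [Fintype.card_option, this, hc])
  exact ⟨_, ⟨f.trans (PartitionLattice.setoidCongr (Fintype.equivFin (Option A)))⟩⟩

end Counts

/-! ### Downsets and their duals -/

section Downset

variable {L : Type u} [PartialOrder L] {G : Type*} [PartialOrder G] {x : L}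

/-- The element of `L` that corresponds to `y : G` under an identification of the downset of `x`
with the dual of `G`. -/
def dualElement (θ : Set.Iic x ≃o Gᵒᵈ) (y : G) : L := (θ.symm (OrderDual.toDual y)).1

theorem dualElement_le_iff (θ : Set.Iic x ≃o Gᵒᵈ) {y z : G} :
    dualElement θ y ≤ dualElement θ z ↔ z ≤ y :=
  Subtype.coe_le_coe.trans (θ.symm.le_iff_le.trans OrderDual.toDual_le_toDual)

theorem exists_dualElement_eq (θ : Set.Iic x ≃o Gᵒᵈ) {w : L} (hw : w ≤ x) :
    ∃ y, dualElement θ y = w :=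
  ⟨OrderDual.ofDual (θ ⟨w, hw⟩), congrArg Subtype.val (θ.symm_apply_apply ⟨w, hw⟩)⟩

theorem dualElement_le (θ : Set.Iic x ≃o Gᵒᵈ) (y : G) : dualElement θ y ≤ x :=
  (θ.symm (OrderDual.toDual y)).2

/-- Principal ideals below `x` are dual to principal filters. -/
def iciDualIso (θ : Set.Iic x ≃o Gᵒᵈ) (y : G) : (Set.Ici y)ᵒᵈ ≃o Set.Iic (dualElement θ y) where
  toFun z := ⟨dualElement θ (OrderDual.ofDual z).1,
    (dualElement_le_iff θ).2 (OrderDual.ofDual z).2⟩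
  invFun w := OrderDual.toDual ⟨OrderDual.ofDual (θ ⟨w.1, w.2.trans (dualElement_le θ y)⟩), by
    rw [Set.mem_Ici, ← dualElement_le_iff θ]
    simpa [dualElement] using w.2⟩
  left_inv z := by simp [dualElement]
  right_inv w := Subtype.ext (by simp [dualElement])
  map_rel_iff' {z w} := dualElement_le_iff θ

theorem height_dualElement (θ : Set.Iic x ≃o Gᵒᵈ) (y : G) :
    Order.height (dualElement θ y) = Order.coheight y := by
  have h : (Order.height (dualElement θ y) : WithBot ℕ∞) = Order.coheight y := by
    rw [Order.height_eq_krullDim_Iic, Order.coheight_eq_krullDim_Ici,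
      ← Order.krullDim_eq_of_orderIso (iciDualIso θ y), Order.krullDim_orderDual]
  exact_mod_cast h

theorem encard_covBy_dualElement (θ : Set.Iic x ≃o Gᵒᵈ) (y : G) :
    {w | w ⋖ dualElement θ y}.encard = {z | y ⋖ z}.encard := by
  have hinj : Function.Injective (dualElement θ) := fun a b h =>
    le_antisymm ((dualElement_le_iff θ).1 h.ge) ((dualElement_le_iff θ).1 h.le)
  have hlt : ∀ {a b}, dualElement θ a < dualElement θ b ↔ b < a := by
    intro a b; simp only [lt_iff_le_not_ge, dualElement_le_iff]
  rw [← hinj.encard_image]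
  congr 1
  ext w
  simp only [Set.mem_image, Set.mem_ofPred_eq]
  constructor
  · intro h
    obtain ⟨z, rfl⟩ := exists_dualElement_eq θ (h.le.trans (dualElement_le θ y))
    exact ⟨z, ⟨hlt.1 h.lt, fun c hyc hcz => h.2 (hlt.2 hcz) (hlt.2 hyc)⟩, rfl⟩
  · rintro ⟨z, h, rfl⟩
    refine ⟨hlt.2 h.lt, fun c hzc hcy => ?_⟩
    obtain ⟨c, rfl⟩ := exists_dualElement_eq θ (hcy.le.trans (dualElement_le θ y))
    exact h.2 (hlt.1 hcy) (hlt.1 hzc)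

theorem dualElement_bot [OrderBot G] (θ : Set.Iic x ≃o Gᵒᵈ) : dualElement θ ⊥ = x := by
  obtain ⟨y, hy⟩ := exists_dualElement_eq θ (le_refl x)
  exact le_antisymm (dualElement_le θ ⊥) (hy.ge.trans ((dualElement_le_iff θ).2 bot_le))

/-- In an algebraic poset, elements of finite height are compact, because a directed set below such
an element contains its supremum. -/
theorem IsScottDomain.isCompactElement_of_height_lt_top (hL : IsScottDomain L)
    (hx : Order.height x < ⊤) : IsCompactElement x := by
  obtain ⟨D, hD, ⟨d₀, hd₀⟩, hdir, hlub⟩ := hL.algebraic x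
  by_contra hxD
  have hunb : ∀ n : ℕ, ∃ d ∈ D, (n : ℕ∞) ≤ Order.height d := by
    intro n
    induction n with
    | zero => exact ⟨d₀, hd₀, by simp⟩
    | succ n ih =>
      obtain ⟨d, hd, hn⟩ := ih
      obtain ⟨e, he, hed⟩ : ∃ e ∈ D, ¬ e ≤ d := by
        by_contra! h
        exact hxD ((le_antisymm (hlub.2 h) (hlub.1 hd)) ▸ hD d hd)
      obtain ⟨f, hf, hdf, hef⟩ := hdir d hd e he
      refine ⟨f, hf, le_trans ?_ (Order.height_add_one_le
        (lt_of_le_of_ne hdf fun h => hed (h ▸ hef)))⟩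
      push_cast
      exact add_le_add_left hn 1
  obtain ⟨n, hn⟩ := ENat.ne_top_iff_exists.1 hx.ne
  obtain ⟨d, hd, hd'⟩ := hunb (n + 1)
  have := hd'.trans (Order.height_mono (hlub.1 hd))
  rw [← hn] at this
  exact absurd (by exact_mod_cast this) (Nat.not_succ_le_self n)

end Downset

/-! ### Duals of geometric and of partition lattices -/

section Dual

theorem IsModularElement.toDual {M : Type u} [Lattice M] {z : M} (hz : IsModularElement z) :
    IsModularElement (OrderDual.toDual z) := by
  intro a y hay
  have h := hz (OrderDual.ofDual y) (OrderDual.ofDual a) hay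
  change OrderDual.ofDual a ⊓ (z ⊔ OrderDual.ofDual y) =
    (OrderDual.ofDual a ⊓ z) ⊔ OrderDual.ofDual y
  rw [inf_comm, sup_comm z, ← h, sup_comm, inf_comm]

theorem isGeometricLattice_setoid (V : Type u) [Finite V] : IsGeometricLattice (Setoid V) :=
  ⟨inferInstance, inferInstance, fun _ _ => IsUpperModularLattice.covBy_sup_of_inf_covBy⟩

theorem IsDualToFinitePartitionLattice.exists_setoid {α : Type u} [PartialOrder α]
    (h : IsDualToFinitePartitionLattice α) :
    ∃ V : Type u, Finite V ∧ Nonempty (α ≃o (Setoid V)ᵒᵈ) := by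
  obtain ⟨n, ⟨θ⟩⟩ := h
  exact ⟨ULift (Fin n), inferInstance,
    ⟨θ.trans (PartitionLattice.setoidCongr Equiv.ulift.symm).dual⟩⟩

theorem IsDualToFinitePartitionLattice.isCogeometric {α : Type u} [PartialOrder α]
    (h : IsDualToFinitePartitionLattice α) : IsCogeometric α := by
  obtain ⟨V, _, hθ⟩ := h.exists_setoid
  exact ⟨Setoid V, inferInstance, inferInstance, isGeometricLattice_setoid V, hθ⟩

theorem IsDualToFinitePartitionLattice.hasModularAtom {α : Type u} [PartialOrder α] [Nontrivial α]
    (h : IsDualToFinitePartitionLattice α) : HasModularAtom α := by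
  obtain ⟨V, _, ⟨θ⟩⟩ := h.exists_setoid
  have : Nontrivial V := by
    by_contra hV
    rw [not_nontrivial_iff_subsingleton] at hV
    have : Subsingleton (Setoid V) := ⟨fun R S => by
      ext a b; rw [Subsingleton.elim a b]; exact iff_of_true (R.refl' b) (S.refl' b)⟩
    exact not_subsingleton α (θ.injective.subsingleton (β := (Setoid V)ᵒᵈ))
  obtain ⟨v⟩ : Nonempty V := inferInstance
  exact ⟨(Setoid V)ᵒᵈ, inferInstance, inferInstance, ⟨θ⟩, _,
    (PartitionLattice.isCoatom_block_compl_singleton v).dual,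
    (PartitionLattice.isModularElement_block_compl_singleton v).toDual⟩

theorem HasModularAtom.exists_isModularCoatomAbove {G : Type u} [Lattice G] [BoundedOrder G]
    {y : G} {α : Type u} [PartialOrder α] (h : HasModularAtom α) (θ : (Set.Ici y)ᵒᵈ ≃o α) :
    ∃ H, IsModularCoatomAbove y H := by
  obtain ⟨M, _, _, ⟨κ⟩, z, hz, hmod⟩ := h
  let ψ : (Set.Ici y)ᵒᵈ ≃o M := θ.trans κ
  have hatom : IsAtom (ψ.symm z) := (ψ.symm.isAtom_iff z).2 hz
  refine ⟨(OrderDual.ofDual (ψ.symm z)).1, (OrderDual.ofDual (ψ.symm z)).2,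
    IsCoatom.of_isCoatom_coe_Ici hatom.dual, fun a b ha hab => ?_⟩
  let a' : (Set.Ici y)ᵒᵈ := OrderDual.toDual ⟨a, ha⟩
  let b' : (Set.Ici y)ᵒᵈ := OrderDual.toDual ⟨b, ha.trans hab⟩
  have hab' : b' ≤ a' := hab
  have key := congrArg ψ.symm (hmod (ψ b') (ψ a') (ψ.le_iff_le.2 hab'))
  rw [map_sup, map_inf, map_inf, map_sup, ψ.symm_apply_apply, ψ.symm_apply_apply] at key
  have key' : b ⊓ ((OrderDual.ofDual (ψ.symm z)).1 ⊔ a) =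
      (b ⊓ (OrderDual.ofDual (ψ.symm z)).1) ⊔ a :=
    congrArg (fun t : (Set.Ici y)ᵒᵈ => (OrderDual.ofDual t).1) key
  rw [sup_comm a, inf_comm _ b, ← key', inf_comm, sup_comm]

end Dual

/-! ### The characterization of piecewise Boolean domains -/

theorem mainTheorem4 (L : Type u) [PartialOrder L] :
    IsPiecewiseBooleanDomain L ↔
      IsScottDomain L ∧
      (∀ x : L, IsCompactElement x →
        IsCogeometric (Set.Iic x) ∧ (¬ IsMin x → HasModularAtom (Set.Iic x))) ∧
      (∀ (x : L) (n : ℕ), n ≤ 3 → Order.height x = n →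
        {y : L | y ⋖ x}.encard = (n + 1).choose 2) := by
  constructor
  · intro hL
    refine ⟨hL.toIsScottDomain, fun x hx => ⟨(hL.downset x hx).isCogeometric, fun hmin => ?_⟩,
      fun x n _ hn => ?_⟩
    · obtain ⟨y, hy⟩ := not_isMin_iff.1 hmin
      have : Nontrivial (Set.Iic x) :=
        ⟨⟨y, hy.le⟩, ⟨x, le_rfl⟩, fun h => hy.ne (congrArg Subtype.val h)⟩
      exact (hL.downset x hx).hasModularAtom
    · obtain ⟨m, ⟨θ⟩⟩ := hL.downset x
        (hL.isCompactElement_of_height_lt_top (hn ▸ ENat.natCast_lt_top n))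
      have hh := height_dualElement θ ⊥
      have hc := encard_covBy_dualElement θ ⊥
      rw [dualElement_bot, hn, PartitionLattice.coheight_bot] at hh
      rw [dualElement_bot, PartitionLattice.encard_covBy_bot] at hc
      rw [hc]
      replace hh : n = m - 1 := by exact_mod_cast hh
      rcases Nat.eq_zero_or_pos m with rfl | hm
      · subst hh; rfl
      · rw [hh, Nat.sub_add_cancel hm]
  · rintro ⟨hL, hgeom, hcount⟩
    refine ⟨hL, fun x hx => ?_⟩
    obtain ⟨⟨G, _, _, ⟨_, _, hsm⟩, ⟨θ⟩⟩, -⟩ := hgeom x hx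
    have : IsUpperModularLattice G := ⟨hsm _ _⟩
    have hheight : ∀ y : G, Order.height (dualElement θ y) = corank y := fun y => by
      rw [height_dualElement, coe_corank]
    obtain ⟨n, ⟨f⟩⟩ := exists_orderIso_setoid_fin (G := G)
      (fun y hy => by
        have hmin : ¬ IsMin (dualElement θ y) := fun hmin =>
          hy (top_le_iff.1 ((dualElement_le_iff θ).1 (hmin ((dualElement_le_iff θ).2 le_top))))
        exact ((hgeom _ (hL.isCompactElement_of_height_lt_top
          (hheight y ▸ ENat.natCast_lt_top _))).2 hmin).exists_isModularCoatomAbove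
            (iciDualIso θ y))
      (fun y hy => by
        have := hcount _ _ hy (hheight y)
        rw [encard_covBy_dualElement] at this
        rw [Set.ncard, this]
        rfl)
    exact ⟨n, ⟨θ.trans f.dual⟩⟩
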